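/- A quantum Latin square (QLS) of dimension $v$ is a $v\times v$ array $\Phi=(\Phi_{ij})$ of vectors of $\mathbb{C}^v$ such that every row and every column is an orthonormal basis of $\mathbb{C}^v$; it is idempotent if its diagonal $\Phi_{11},\dots,\Phi_{vv}$ is also an orthonormal basis of $\mathbb{C}^v$. It is classical if there are a Latin square $L$ of order $v$, a unitary operator $U$ on $\mathbb{C}^v$, complex numbers $c_{ij}$ of modulus $1$ and permutations $\sigma,\tau$ of the indices such that $\Phi_{ij}=c_{ij}\,U\,e_{L_{\sigma(i),\tau(j)}}$ for all $i,j$, where $e_1,\dots,e_v$ is the standard basis of $\mathbb{C}^v$; otherwise it is non-classical. Two QLSs $\Phi,\Psi$ of dimension $v$ are orthogonal if the $v^2$ vectors $\Phi_{ij}\otimes\Psi_{ij}$ form an orthonormal basis of $\mathbb{C}^v\otimes\mathbb{C}^v$. **Theorem.** For every integer $v\ge 6$ with $v\notin\{6,7,8,9,10,11,12,14,15,18,19,23\}$ there exist two orthogonal idempotent quantum Latin squares of dimension $v$, both of which are non-classical. -/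

import Mathlib

open scoped TensorProduct

namespace QuantumLatin

/-- The complex space `ℂ^v` with its standard Hermitian inner product. -/
abbrev CSpace (v : ℕ) : Type := EuclideanSpace ℂ (Fin v)

/-- `v × v` arrays of vectors of `ℂ^v`. -/
abbrev VecArray (v : ℕ) : Type := Fin v → Fin v → CSpace v

/-- The family `b` is an orthonormal basis of the inner product space `E`. -/
def IsOrthoBasis {ι E : Type*} [NormedAddCommGroup E] [InnerProductSpace ℂ E]
    (b : ι → E) : Prop :=
  Orthonormal ℂ b ∧ Submodule.span ℂ (Set.range b) = ⊤

/-- Latin squares of order `v`: every symbol occurs exactly once in each row and column. -/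
def IsLatinSquare {v : ℕ} (L : Fin v → Fin v → Fin v) : Prop :=
  (∀ i k, ∃! j, L i j = k) ∧ ∀ j k, ∃! i, L i j = k

/-- Quantum Latin squares of dimension `v`. -/
def IsQLS {v : ℕ} (Φ : VecArray v) : Prop :=
  (∀ i, IsOrthoBasis fun j => Φ i j) ∧ ∀ j, IsOrthoBasis fun i => Φ i j

/-- The array obtained by writing the computational basis vector `|l⟩` for each symbol `l`. -/
noncomputable def ofSymbols {v : ℕ} (L : Fin v → Fin v → Fin v) : VecArray v :=
  fun i j => EuclideanSpace.single (L i j) (1 : ℂ)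

/-- Equivalence of `Φ` and `Ψ`: `Ψ i j = c i j • U (Φ (σ i) (τ j))` with `U` unitary,
the `c i j` of modulus one, and `σ`, `τ` permutations. -/
def Equivalent {v : ℕ} (Φ Ψ : VecArray v) : Prop :=
  ∃ (U : CSpace v ≃ₗᵢ[ℂ] CSpace v) (c : Fin v → Fin v → ℂ) (σ τ : Equiv.Perm (Fin v)),
    (∀ i j, ‖c i j‖ = 1) ∧ ∀ i j, Ψ i j = c i j • U (Φ (σ i) (τ j))

/-- Classical quantum Latin squares: those equivalent to one that comes from a Latin square. -/
def IsClassical {v : ℕ} (Φ : VecArray v) : Prop :=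
  ∃ L : Fin v → Fin v → Fin v, IsLatinSquare L ∧ Equivalent (ofSymbols L) Φ

/-- Idempotency: the diagonal is an orthonormal basis of `ℂ^v`. -/
def IsIdempotent {v : ℕ} (Φ : VecArray v) : Prop :=
  IsOrthoBasis fun i => Φ i i

/-- Orthogonality: the vectors `Φ i j ⊗ Ψ i j` form an orthonormal basis of `ℂ^v ⊗ ℂ^v`. -/
def AreOrthogonal {v : ℕ} (Φ Ψ : VecArray v) : Prop :=
  IsOrthoBasis fun p : Fin v × Fin v => (Φ p.1 p.2 ⊗ₜ[ℂ] Ψ p.1 p.2 : CSpace v ⊗[ℂ] CSpace v)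

/-- `t` mutually orthogonal idempotent quantum Latin squares of dimension `v`. -/
def IsIdempotentMOQLS {t v : ℕ} (F : Fin t → VecArray v) : Prop :=
  (∀ f, IsQLS (F f) ∧ IsIdempotent (F f)) ∧ ∀ f g, f < g → AreOrthogonal (F f) (F g)

end QuantumLatin

/-!
Both quantum Latin squares come from one classical object, an idempotent Latin square `op` on
`Fin v` that is orthogonal to its transpose and contains a subsquare on a proper subset `S` of the
symbols with at least two elements. Write `|op i j⟩` in cell `(i, j)`, and inside `S × S` replace it
by `U |op i j⟩`, where `U` is a rotation of `ℂ^S` in the plane of two basis vectors. Rows, columns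
and the diagonal stay orthonormal because each of them meets `S × S` in nothing or in a basis of
`ℂ^S`; the tensor products with the transposed array stay orthonormal because the cells of `S × S`
carry a basis of `ℂ^S ⊗ ℂ^S`, which `U ⊗ U` preserves. A rotated symbol also occurs unrotated
outside `S × S`, so two entries are neither parallel nor orthogonal, and this is impossible for a
classical square (`not_isClassical_rotatedArray`).

It remains to construct the square `op` for each order (`hasSOLSWithSub`). The general tool is that
a pairwise balanced design whose blocks carry idempotent self-orthogonal Latin squares carries one
itself, with the blocks as subsquares (`exists_isSOLS_of_design`). Applied to a transversal design
with five groups of size `m`, one of them truncated to `t` points, this yields order `4m + t`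
(`HasSlopes.hasSOLSWithSub`). Such designs are affine planes over rings with enough units, for
instance `ZMod m` with `m` coprime to `6`, where `m = 6q + 1` and `7 ≤ t ≤ 30` suffice for all
orders above `130`. The orders up to `130` that this does not reach, and the small orders needed as
`t`, are obtained by developing a row over `ZMod n` with `k` fixed points at infinity, whose square
is filled in with one of order `k` (`IsStarter.isSOLS`), from explicit lists checked by evaluation;
three of them are products.
-/

namespace SelfOrthogonal

/-! ### Idempotent self-orthogonal Latin squares -/

/-- `op` is the multiplication table of an idempotent self-orthogonal Latin square on `X`:
the square is orthogonal to its transpose. On a finite `X` injectivity is all that is needed. -/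
structure IsSOLS {X : Type*} (op : X → X → X) : Prop where
  idem : ∀ x, op x x = x
  left_inj : ∀ x, Function.Injective (op x)
  right_inj : ∀ y, Function.Injective fun x => op x y
  self_orth : ∀ ⦃x y x' y'⦄, op x y = op x' y' → op y x = op y' x' → x = x' ∧ y = y'

/-- `S` carries a subsquare of `op` that is neither a single cell nor the whole square. -/
structure IsProperSub {X : Type*} (op : X → X → X) (S : Set X) : Prop where
  closed : ∀ x ∈ S, ∀ y ∈ S, op x y ∈ S
  nontrivial : S.Nontrivial
  ne_univ : S ≠ Set.univ

/-- There is an idempotent self-orthogonal Latin square of order `n`. -/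
def HasSOLS (n : ℕ) : Prop := ∃ op : Fin n → Fin n → Fin n, IsSOLS op

/-- There is an idempotent self-orthogonal Latin square of order `n` with a proper subsquare. -/
def HasSOLSWithSub (n : ℕ) : Prop :=
  ∃ (op : Fin n → Fin n → Fin n) (S : Set (Fin n)), IsSOLS op ∧ IsProperSub op S

theorem HasSOLSWithSub.hasSOLS {n : ℕ} : HasSOLSWithSub n → HasSOLS n :=
  fun ⟨op, _, h, _⟩ => ⟨op, h⟩

theorem IsSOLS.flip {X : Type*} {op : X → X → X} (h : IsSOLS op) : IsSOLS (flip op) where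
  idem := h.idem
  left_inj := h.right_inj
  right_inj := h.left_inj
  self_orth _ _ _ _ h₁ h₂ := h.self_orth h₂ h₁

theorem IsProperSub.flip {X : Type*} {op : X → X → X} {S : Set X} (h : IsProperSub op S) :
    IsProperSub (flip op) S :=
  ⟨fun x hx y hy => h.closed y hy x hx, h.nontrivial, h.ne_univ⟩

theorem IsSOLS.transport {X Y : Type*} {op : X → X → X} (h : IsSOLS op) (e : X ≃ Y) :
    IsSOLS fun x y => e (op (e.symm x) (e.symm y)) where
  idem x := by simp [h.idem]
  left_inj x := e.injective.comp ((h.left_inj _).comp e.symm.injective)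
  right_inj y := e.injective.comp ((h.right_inj (e.symm y)).comp e.symm.injective)
  self_orth x y x' y' h₁ h₂ := by
    have := h.self_orth (e.injective h₁) (e.injective h₂)
    exact ⟨e.symm.injective this.1, e.symm.injective this.2⟩

theorem IsProperSub.transport {X Y : Type*} {op : X → X → X} {S : Set X} (h : IsProperSub op S)
    (e : X ≃ Y) : IsProperSub (fun x y => e (op (e.symm x) (e.symm y))) (e.symm ⁻¹' S) where
  closed x hx y hy := by simpa using h.closed _ hx _ hy
  nontrivial := h.nontrivial.preimage e.symm.surjective
  ne_univ H := h.ne_univ <| by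
    rw [← Set.image_preimage_eq S e.symm.surjective, H, Set.image_univ, e.symm.range_eq_univ]

theorem HasSOLS.of_isSOLS {X : Type*} [Finite X] {n : ℕ} (hn : Nat.card X = n) {op : X → X → X}
    (h : IsSOLS op) : HasSOLS n :=
  ⟨_, h.transport (Finite.equivFinOfCardEq hn)⟩

theorem HasSOLSWithSub.of_isSOLS {X : Type*} [Finite X] {n : ℕ} (hn : Nat.card X = n)
    {op : X → X → X} {S : Set X} (h : IsSOLS op) (hS : IsProperSub op S) : HasSOLSWithSub n :=
  ⟨_, _, h.transport (Finite.equivFinOfCardEq hn), hS.transport _⟩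

theorem HasSOLS.exists_isSOLS {X : Type*} [Finite X] (h : HasSOLS (Nat.card X)) :
    ∃ op : X → X → X, IsSOLS op :=
  let ⟨_, hop⟩ := h
  ⟨_, hop.transport (Finite.equivFin X).symm⟩

theorem HasSOLS.of_le_one {n : ℕ} (hn : n ≤ 1) : HasSOLS n := by
  have : Subsingleton (Fin n) := Fin.subsingleton_iff_le_one.2 hn
  exact ⟨fun x _ => x, fun _ => rfl, fun _ _ _ _ => Subsingleton.elim _ _,
    fun _ _ _ _ => Subsingleton.elim _ _,
    fun _ _ _ _ _ _ => ⟨Subsingleton.elim _ _, Subsingleton.elim _ _⟩⟩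

theorem IsSOLS.prod {X Y : Type*} {op : X → X → X} {op' : Y → Y → Y} (h : IsSOLS op)
    (h' : IsSOLS op') : IsSOLS fun p q : X × Y => (op p.1 q.1, op' p.2 q.2) where
  idem p := by simp [h.idem, h'.idem]
  left_inj p q q' H := by
    simp only [Prod.mk.injEq] at H
    exact Prod.ext (h.left_inj _ H.1) (h'.left_inj _ H.2)
  right_inj p q q' H := by
    simp only [Prod.mk.injEq] at H
    exact Prod.ext (h.right_inj _ H.1) (h'.right_inj _ H.2)
  self_orth p q p' q' H₁ H₂ := by
    simp only [Prod.mk.injEq] at H₁ H₂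
    have a := h.self_orth H₁.1 H₂.1
    have b := h'.self_orth H₁.2 H₂.2
    exact ⟨Prod.ext a.1 b.1, Prod.ext a.2 b.2⟩

/-- In a product, every fibre is a subsquare because the first factor is idempotent. -/
theorem HasSOLS.mul {m n : ℕ} (hm : 2 ≤ m) (hn : 2 ≤ n) (h : HasSOLS m) (h' : HasSOLS n) :
    HasSOLSWithSub (m * n) := by
  obtain ⟨op, h⟩ := h
  obtain ⟨op', h'⟩ := h'
  let a : Fin m := ⟨0, by omega⟩
  let b : Fin m := ⟨1, by omega⟩
  let c : Fin n := ⟨0, by omega⟩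
  let d : Fin n := ⟨1, by omega⟩
  refine .of_isSOLS (by simp) (h.prod h') (S := {p | p.1 = a}) ⟨?_, ?_, ?_⟩
  · intro p hp q hq
    simp only [Set.mem_ofPred_eq] at hp hq ⊢
    rw [hp, hq, h.idem]
  · exact ⟨(a, c), rfl, (a, d), rfl, by simp [c, d]⟩
  · intro H
    have : (b, c) ∈ {p : Fin m × Fin n | p.1 = a} := H ▸ Set.mem_univ _
    simp [a, b] at this

/-! ### Pairwise balanced designs -/

/-- A pairwise balanced design whose blocks carry idempotent self-orthogonal Latin squares carries
one on its whole point set, and every block is a subsquare: the product of two points is formed in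
a block through them. -/
theorem exists_isSOLS_of_design {X ι : Type*} [Finite X] (B : ι → Set X)
    (hex : ∀ x y, ∃ i, x ∈ B i ∧ y ∈ B i)
    (huniq : ∀ i j x y, x ≠ y → x ∈ B i → y ∈ B i → x ∈ B j → y ∈ B j → i = j)
    (hB : ∀ i, HasSOLS (B i).ncard) :
    ∃ op : X → X → X, IsSOLS op ∧ ∀ i, ∀ x ∈ B i, ∀ y ∈ B i, op x y ∈ B i := by
  have hB' : ∀ i, ∃ op : B i → B i → B i, IsSOLS op := fun i => (hB i).exists_isSOLS
  choose o ho using hB'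
  choose i hi using hex
  let op : X → X → X := fun x y => o (i x y) ⟨x, (hi x y).1⟩ ⟨y, (hi x y).2⟩
  have hop : ∀ j (x y : B j), op x y = o j x y := by
    rintro j ⟨x, hx⟩ ⟨y, hy⟩
    by_cases hxy : x = y
    · subst hxy
      simp [op, (ho _).idem]
    · have key : ∀ (j' : ι) (hx' : x ∈ B j') (hy' : y ∈ B j'),
          (o j' ⟨x, hx'⟩ ⟨y, hy'⟩ : X) = o j ⟨x, hx⟩ ⟨y, hy⟩ := by
        intro j' hx' hy'
        obtain rfl := huniq j' j x y hxy hx' hy' hx hy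
        rfl
      exact key _ _ _
  have hop' : ∀ j x y (hx : x ∈ B j) (hy : y ∈ B j), op x y = o j ⟨x, hx⟩ ⟨y, hy⟩ :=
    fun j x y hx hy => hop j ⟨x, hx⟩ ⟨y, hy⟩
  have hidem : ∀ x, op x x = x := fun x => by simp [op, (ho _).idem]
  have hmem : ∀ j, ∀ x ∈ B j, ∀ y ∈ B j, op x y ∈ B j := by
    intro j x hx y hy
    rw [hop' j x y hx hy]
    exact Subtype.coe_prop _
  have hleft : ∀ x y, op x y = x → y = x := by
    intro x y h
    obtain ⟨j, hx, hy⟩ : ∃ j, x ∈ B j ∧ y ∈ B j := ⟨_, hi x y⟩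
    replace h := h.trans (hidem x).symm
    rw [hop' j x y hx hy, hop' j x x hx hx] at h
    simpa using (ho j).left_inj _ (Subtype.ext h)
  have hright : ∀ x y, op x y = y → x = y := by
    intro x y h
    obtain ⟨j, hx, hy⟩ : ∃ j, x ∈ B j ∧ y ∈ B j := ⟨_, hi x y⟩
    replace h := h.trans (hidem y).symm
    rw [hop' j x y hx hy, hop' j y y hy hy] at h
    simpa using (ho j).right_inj _ (Subtype.ext h)
  have hsymm : ∀ x y, op x y = op y x → x = y := by
    intro x y h
    obtain ⟨j, hx, hy⟩ : ∃ j, x ∈ B j ∧ y ∈ B j := ⟨_, hi x y⟩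
    rw [hop' j x y hx hy, hop' j y x hy hx] at h
    simpa using ((ho j).self_orth (Subtype.ext h) (Subtype.ext h.symm)).1
  refine ⟨op, ⟨hidem, ?_, ?_, ?_⟩, hmem⟩
  · intro x y y' h
    by_cases hz : op x y = x
    · rw [hleft x y hz, hleft x y' (h ▸ hz)]
    obtain ⟨j, hx, hy⟩ : ∃ j, x ∈ B j ∧ y ∈ B j := ⟨_, hi x y⟩
    obtain ⟨j', hx', hy'⟩ : ∃ j, x ∈ B j ∧ y' ∈ B j := ⟨_, hi x y'⟩
    obtain rfl := huniq j j' _ x hz (hmem j x hx y hy) hx (h ▸ hmem j' x hx' y' hy') hx'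
    rw [hop' j x y hx hy, hop' j x y' hx hy'] at h
    simpa using (ho j).left_inj _ (Subtype.ext h)
  · intro y x x' h
    change op x y = op x' y at h
    by_cases hz : op x y = y
    · rw [hright x y hz, hright x' y (h ▸ hz)]
    obtain ⟨j, hx, hy⟩ : ∃ j, x ∈ B j ∧ y ∈ B j := ⟨_, hi x y⟩
    obtain ⟨j', hx', hy'⟩ : ∃ j, x' ∈ B j ∧ y ∈ B j := ⟨_, hi x' y⟩
    obtain rfl := huniq j j' _ y hz (hmem j x hx y hy) hy (h ▸ hmem j' x' hx' y hy') hy'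
    rw [hop' j x y hx hy, hop' j x' y hx' hy] at h
    simpa using (ho j).right_inj _ (Subtype.ext h)
  · intro x y x' y' h₁ h₂
    by_cases hz : op x y = op y x
    · obtain rfl := hsymm x y hz
      obtain rfl := hsymm x' y' (h₁ ▸ h₂ ▸ hz)
      rw [hidem, hidem] at h₁
      exact ⟨h₁, h₁⟩
    obtain ⟨j, hx, hy⟩ : ∃ j, x ∈ B j ∧ y ∈ B j := ⟨_, hi x y⟩
    obtain ⟨j', hx', hy'⟩ : ∃ j, x' ∈ B j ∧ y' ∈ B j := ⟨_, hi x' y'⟩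
    obtain rfl := huniq j j' _ _ hz (hmem j x hx y hy) (hmem j y hy x hx)
      (h₁ ▸ hmem j' x' hx' y' hy') (h₂ ▸ hmem j' y' hy' x' hx')
    rw [hop' j x y hx hy, hop' j x' y' hx' hy'] at h₁
    rw [hop' j y x hy hx, hop' j y' x' hy' hx'] at h₂
    simpa using (ho j).self_orth (Subtype.ext h₁) (Subtype.ext h₂)

/-! ### Rings with many units -/

/-- `a` and `b` are such that all differences of `0, 1, a, b` are units, so that the lines of slopes
`0, 1, a, b, ∞` in the plane `R × R` form a transversal design with five groups. Moreover `2a - 1`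
is a unit, so that `a x + (1 - a) y` is an idempotent self-orthogonal Latin square. -/
structure IsSlopePair {R : Type*} [CommRing R] (a b : R) : Prop where
  unit_a : IsUnit a
  unit_b : IsUnit b
  unit_a_sub : IsUnit (a - 1)
  unit_b_sub : IsUnit (b - 1)
  unit_sub : IsUnit (a - b)
  unit_two_mul_sub : IsUnit (2 * a - 1)

/-- There is a commutative ring of order `n` with a pair of slopes. -/
def HasSlopes (n : ℕ) : Prop :=
  ∃ (R : Type) (_ : CommRing R) (_ : Finite R), Nat.card R = n ∧ ∃ a b : R, IsSlopePair a b

theorem HasSlopes.mul {m n : ℕ} : HasSlopes m → HasSlopes n → HasSlopes (m * n) := by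
  rintro ⟨R, _, _, hm, a, b, h⟩ ⟨R', _, _, hn, a', b', h'⟩
  refine ⟨R × R', inferInstance, inferInstance, by rw [Nat.card_prod, hm, hn],
    (a, a'), (b, b'), ?_, ?_, ?_, ?_, ?_, ?_⟩ <;> rw [Prod.isUnit_iff]
  exacts [⟨h.unit_a, h'.unit_a⟩, ⟨h.unit_b, h'.unit_b⟩, ⟨h.unit_a_sub, h'.unit_a_sub⟩,
    ⟨h.unit_b_sub, h'.unit_b_sub⟩, ⟨h.unit_sub, h'.unit_sub⟩,
    ⟨h.unit_two_mul_sub, h'.unit_two_mul_sub⟩]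

theorem HasSlopes.of_coprime_six {n : ℕ} (hn : n.Coprime 6) : HasSlopes n := by
  have : NeZero n := ⟨by rintro rfl; simp at hn⟩
  have h2 : IsUnit (2 : ZMod n) := by
    exact_mod_cast (ZMod.isUnit_iff_coprime 2 n).2 (hn.coprime_dvd_right (by norm_num)).symm
  have h3 : IsUnit (3 : ZMod n) := by
    exact_mod_cast (ZMod.isUnit_iff_coprime 3 n).2 (hn.coprime_dvd_right (by norm_num)).symm
  refine ⟨ZMod n, inferInstance, inferInstance, Nat.card_zmod n, 2, 3, h2, h3, ?_, ?_, ?_, ?_⟩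
  · rw [show (2 : ZMod n) - 1 = 1 by ring]
    exact isUnit_one
  · rwa [show (3 : ZMod n) - 1 = 2 by ring]
  · rw [show (2 : ZMod n) - 3 = -1 by ring]
    exact isUnit_one.neg
  · rwa [show (2 : ZMod n) * 2 - 1 = 3 by ring]

theorem HasSlopes.of_prime_pow {p k : ℕ} (hp : p.Prime) (hk : k ≠ 0) (h : 4 ≤ p ^ k) :
    HasSlopes (p ^ k) := by
  have : Fact p.Prime := ⟨hp⟩
  classical
  have : Fintype (GaloisField p k) := Fintype.ofFinite _
  have hc : Fintype.card (GaloisField p k) = p ^ k := by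
    rw [← Nat.card_eq_fintype_card, GaloisField.card p k hk]
  have hodd : (2 : GaloisField p k) ≠ 0 → 4 ≠ p ^ k := fun h2 h4 => by
    have := FiniteField.cast_card_eq_zero (GaloisField p k)
    rw [hc, ← h4] at this
    refine h2 (pow_eq_zero_iff two_ne_zero |>.1 ?_)
    rw [← this]
    norm_num
  obtain ⟨a, ha0, ha1, ha⟩ : ∃ a : GaloisField p k, a ≠ 0 ∧ a ≠ 1 ∧ 2 * a - 1 ≠ 0 := by
    have hlt : ({0, 1, 2⁻¹} : Finset (GaloisField p k)).card <
        (Finset.univ : Finset (GaloisField p k)).card := by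
      rw [Finset.card_univ, hc]
      by_cases h2 : (2 : GaloisField p k) = 0
      · rw [h2, inv_zero, Finset.pair_comm, Finset.insert_idem]
        exact Finset.card_le_two.trans_lt (by omega)
      · exact Finset.card_le_three.trans_lt (by have := hodd h2; omega)
    obtain ⟨a, -, ha⟩ := Finset.exists_mem_notMem_of_card_lt_card hlt
    simp only [Finset.mem_insert, Finset.mem_singleton, not_or] at ha
    refine ⟨a, ha.1, ha.2.1, fun h => ?_⟩
    exact ha.2.2 (eq_inv_of_mul_eq_one_right (sub_eq_zero.1 h))
  obtain ⟨b, hb⟩ := Finset.exists_mem_notMem_of_card_lt_card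
    (s := {0, 1, a}) (t := (Finset.univ : Finset (GaloisField p k)))
    (by rw [Finset.card_univ, hc]; exact Finset.card_le_three.trans_lt (by omega))
  simp only [Finset.mem_univ, true_and, Finset.mem_insert, Finset.mem_singleton, not_or] at hb
  refine ⟨GaloisField p k, inferInstance, inferInstance, GaloisField.card p k hk, a, b, ?_⟩
  constructor <;> rw [isUnit_iff_ne_zero]
  exacts [ha0, hb.1, sub_ne_zero.2 ha1, sub_ne_zero.2 hb.2.1, sub_ne_zero.2 (Ne.symm hb.2.2), ha]

theorem HasSlopes.hasSOLS {n : ℕ} : HasSlopes n → HasSOLS n := by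
  rintro ⟨R, _, _, hn, a, b, h⟩
  refine .of_isSOLS hn (op := fun x y => a * x + (1 - a) * y) ⟨?_, ?_, ?_, ?_⟩
  · intro x
    ring
  · intro x y y' e
    refine h.unit_a_sub.mul_left_cancel ?_
    linear_combination -e
  · intro y x x' e
    refine h.unit_a.mul_left_cancel ?_
    linear_combination e
  · intro x y x' y' e e'
    have e₁ : x + y = x' + y' := by linear_combination e + e'
    have e₂ : x = x' := by
      refine h.unit_two_mul_sub.mul_left_cancel ?_
      linear_combination e - (1 - a) * e₁
    exact ⟨e₂, by linear_combination e₁ - e₂⟩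

/-! ### Truncated transversal designs -/

/-- Truncating one group of a transversal design with five groups of size `m` to `t` points leaves
`4m + t` points and blocks of sizes `4`, `5`, `m` and `t`. -/
theorem HasSlopes.hasSOLSWithSub {m t : ℕ} (hm : HasSlopes m) (hm2 : 2 ≤ m) (ht : t ≤ m)
    (hst : HasSOLS t) (h4 : HasSOLS 4) (h5 : HasSOLS 5) : HasSOLSWithSub (4 * m + t) := by
  have hsm := hm.hasSOLS
  obtain ⟨R, _, _, hR, a, b, h⟩ := hm
  have : Nonempty (Fin t ↪ R) := by
    have : Fintype R := Fintype.ofFinite R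
    rw [Function.Embedding.nonempty_iff_card_le, ← Nat.card_eq_fintype_card (α := R), hR]
    simpa using ht
  obtain ⟨τ⟩ := this
  let s : Fin 4 → R := ![0, 1, a, b]
  have hs : ∀ i j, i ≠ j → IsUnit (s i - s j) := by
    have := h.unit_a
    have := h.unit_b
    have := h.unit_a_sub
    have := h.unit_b_sub
    have := h.unit_sub
    have (x y : R) : IsUnit (x - y) ↔ IsUnit (y - x) := by rw [← IsUnit.neg_iff, neg_sub]
    intro i j hij
    fin_cases i <;> fin_cases j <;> simp_all [s]
  -- blocks: the lines `(u, w)`, the four full groups, and the truncated group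
  let B : (R × R) ⊕ Option (Fin 4) → Set ((R × Fin 4) ⊕ Fin t)
    | .inl l => {x | Sum.elim (fun p => p.1 = l.1 + s p.2 * l.2) (fun i => τ i = l.2) x}
    | .inr (some j) => {x | Sum.elim (fun p => p.2 = j) (fun _ => False) x}
    | .inr none => {x | Sum.elim (fun _ => False) (fun _ => True) x}
  have hB1 : ∀ l r j, (Sum.inl (r, j) ∈ B (.inl l)) = (r = l.1 + s j * l.2) := fun _ _ _ => rfl
  have hB2 : ∀ l i, (Sum.inr i ∈ B (.inl l)) = (τ i = l.2) := fun _ _ => rfl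
  have hB3 : ∀ k r j, (Sum.inl (r, j) ∈ B (.inr (some k))) = (j = k) := fun _ _ _ => rfl
  have hB4 : ∀ k i, (Sum.inr i ∈ B (.inr (some k))) = False := fun _ _ => rfl
  have hB5 : ∀ p, (Sum.inl p ∈ B (.inr none)) = False := fun _ => rfl
  have hB6 : ∀ i, (Sum.inr i ∈ B (.inr none)) = True := fun _ => rfl
  have hcard : ∀ j, (B (.inr (some j))).ncard = m := by
    intro j
    rw [← hR, ← Set.ncard_univ R, ← Set.ncard_image_of_injective Set.univ
      (f := fun r => (Sum.inl (r, j) : (R × Fin 4) ⊕ Fin t)) (fun _ _ h => by simpa using h)]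
    congr 1
    ext (⟨r, k⟩ | i) <;> simp [hB3, hB4, eq_comm]
  have hdes : ∃ op : (R × Fin 4) ⊕ Fin t → (R × Fin 4) ⊕ Fin t → (R × Fin 4) ⊕ Fin t,
      IsSOLS op ∧ ∀ i, ∀ x ∈ B i, ∀ y ∈ B i, op x y ∈ B i := by
    apply exists_isSOLS_of_design
    · rintro (⟨r, j⟩ | i) (⟨r', j'⟩ | i')
      · by_cases hj : j = j'
        · exact ⟨.inr (some j), rfl, hj.symm⟩
        · obtain ⟨c, hc⟩ := (hs j j' hj).exists_right_inv
          refine ⟨.inl (r - s j * (c * (r - r')), c * (r - r')), ?_, ?_⟩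
          · rw [hB1]
            ring
          · rw [hB1]
            linear_combination (r - r') * hc
      · exact ⟨.inl (r - s j * τ i', τ i'), by rw [hB1]; ring, rfl⟩
      · exact ⟨.inl (r' - s j' * τ i, τ i), rfl, by rw [hB1]; ring⟩
      · exact ⟨.inr none, trivial, trivial⟩
    · have key : ∀ l l' : R × R, ∀ x y, x ≠ y → x ∈ B (.inl l) → y ∈ B (.inl l) →
          x ∈ B (.inl l') → y ∈ B (.inl l') → l = l' := by
        rintro ⟨u, w⟩ ⟨u', w'⟩ x y hxy h₁ h₂ h₃ h₄
        have : w = w' ∧ ∃ z, u + z * w = u' + z * w' := by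
          rcases x with ⟨r, j⟩ | i <;> rcases y with ⟨r', j'⟩ | i' <;>
            simp only [hB1, hB2] at h₁ h₂ h₃ h₄
          · have hj : j ≠ j' := by
              rintro rfl
              exact hxy (by rw [h₁, h₂])
            refine ⟨(hs j j' hj).mul_left_cancel ?_, s j, h₁.symm.trans h₃⟩
            linear_combination h₂ - h₁ + h₃ - h₄
          · exact ⟨h₂.symm.trans h₄, s j, h₁.symm.trans h₃⟩
          · exact ⟨h₁.symm.trans h₃, s j', h₂.symm.trans h₄⟩
          · exact absurd (congrArg Sum.inr (τ.injective (h₁.trans h₂.symm))) hxy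
        obtain ⟨rfl, z, hz⟩ := this
        simpa using hz
      have key' : ∀ (l : R × R) k x y, x ≠ y → x ∈ B (.inl l) → y ∈ B (.inl l) →
          x ∈ B (.inr k) → y ∈ B (.inr k) → False := by
        rintro l (_ | k) (⟨r, j⟩ | i) (⟨r', j'⟩ | i') hxy h₁ h₂ h₃ h₄ <;>
          simp only [hB1, hB2, hB3, hB4, hB5] at h₁ h₂ h₃ h₄
        · exact hxy (congrArg Sum.inr (τ.injective (h₁.trans h₂.symm)))
        · subst h₃ h₄
          exact hxy (by rw [h₁, h₂])
      rintro (l | k) (l' | k') x y hxy h₁ h₂ h₃ h₄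
      · rw [key l l' x y hxy h₁ h₂ h₃ h₄]
      · exact (key' l k' x y hxy h₁ h₂ h₃ h₄).elim
      · exact (key' l' k x y hxy h₃ h₄ h₁ h₂).elim
      · rcases k with _ | k <;> rcases k' with _ | k' <;> rcases x with ⟨r, j⟩ | i <;> first
          | rfl
          | (simp only [hB3, hB4, hB5] at h₁ h₃ <;> (subst h₁ h₃; rfl))
    · rintro (l | _ | j)
      · have hl : B (.inl l) = Set.range (fun j => Sum.inl (l.1 + s j * l.2, j)) ∪
            Sum.inr '' (τ ⁻¹' {l.2}) := by
          ext (⟨r, j⟩ | i)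
          · rw [hB1]
            simp [eq_comm]
          · rw [hB2]
            simp
        have h₁ : (Set.range fun j => (Sum.inl (l.1 + s j * l.2, j) : (R × Fin 4) ⊕ Fin t)).ncard
            = 4 := by
          rw [← Set.image_univ, Set.ncard_image_of_injective _ fun _ _ e => (Prod.ext_iff.1
            (Sum.inl_injective e)).2]
          simp
        have h₂ : (Sum.inr '' (τ ⁻¹' {l.2}) : Set ((R × Fin 4) ⊕ Fin t)).ncard ≤ 1 := by
          rw [Set.ncard_image_of_injective _ Sum.inr_injective, Set.ncard_le_one_iff]
          intro i i' hi hi'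
          exact τ.injective (hi.trans hi'.symm)
        rw [hl, Set.ncard_union_eq, h₁]
        · interval_cases (Sum.inr '' (τ ⁻¹' {l.2}) : Set ((R × Fin 4) ⊕ Fin t)).ncard
          exacts [h4, h5]
        · rw [Set.disjoint_left]
          rintro _ ⟨j, rfl⟩
          simp
      · have : B (.inr none) = Set.range Sum.inr := by
          ext (p | i)
          · rw [hB5]
            simp
          · rw [hB6]
            simp
        rw [this, ← Set.image_univ, Set.ncard_image_of_injective _ Sum.inr_injective]
        simpa using hst
      · rw [hcard]
        exact hsm
  obtain ⟨op, hop, hcl⟩ := hdes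
  have : Nontrivial R := by
    rw [← Finite.one_lt_card_iff_nontrivial, hR]
    omega
  refine .of_isSOLS ?_ hop (S := B (.inr (some 0))) ⟨hcl (.inr (some 0)), ?_, ?_⟩
  · simp [Nat.card_sum, hR, mul_comm]
  · exact ⟨.inl (0, 0), rfl, .inl (1, 0), rfl, by simp⟩
  · intro H
    have : (Sum.inl (0, 1)) ∈ B (.inr (some 0)) := H ▸ Set.mem_univ _
    rw [hB3] at this
    simp at this

/-! ### Squares with a cyclic group of automorphisms -/

section Cyclic

variable {n k : ℕ}

/-- Translation by `t` on `ZMod n` together with `k` points at infinity, which it fixes. -/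
def translate (t : ZMod n) : ZMod n ⊕ Fin k → ZMod n ⊕ Fin k :=
  Sum.map (t + ·) id

/-- A complete invariant of the orbits of translation on pairs of points, not both at infinity.
Pairs of points at infinity receive the junk value `0`. -/
def pairType : ZMod n ⊕ Fin k → ZMod n ⊕ Fin k → ZMod n ⊕ Bool × Fin k
  | .inl a, .inl b => .inl (b - a)
  | .inr j, .inl _ => .inr (false, j)
  | .inl _, .inr j => .inr (true, j)
  | .inr _, .inr _ => .inl 0

/-- Row `0` of the developed square: `f` on `ZMod n` and `h` on the points at infinity. -/
def rowMap (f : ZMod n → ZMod n ⊕ Fin k) (h : Fin k → ZMod n) : ZMod n ⊕ Fin k → ZMod n ⊕ Fin k :=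
  Sum.elim f fun j => .inl (h j)

/-- Column `0` of the developed square, listed by the negatives of the row indices and then by the
points at infinity. -/
def colMap (f : ZMod n → ZMod n ⊕ Fin k) (g : Fin k → ZMod n) : ZMod n ⊕ Fin k → ZMod n ⊕ Fin k :=
  Sum.elim (fun d => translate (-d) (f d)) fun j => .inl (g j)

/-- The type of the pair formed by an entry and its mirror image, as a function of the type of the
position. -/
def pairMap (f : ZMod n → ZMod n ⊕ Fin k) (g h : Fin k → ZMod n) :
    ZMod n ⊕ Bool × Fin k → ZMod n ⊕ Bool × Fin k :=
  Sum.elim (fun d => pairType (f d) (translate d (f (-d))))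
    fun p => .inl (if p.1 then g p.2 - h p.2 else h p.2 - g p.2)

/-- Starting data for a square on `ZMod n` and `k` points `∞_j` that is invariant under
translation: `f d` is the entry in row `0` and column `d`, `g j` the entry in row `∞_j` and column
`0`, and `h j` the entry in row `0` and column `∞_j`. The conditions say that row `0` and column `0`
have no repeated entry, and that the pairs formed by an entry and its mirror image meet every orbit
of translation at most once. The last condition also excludes pairs of points at infinity, because
their junk type `0` is already the type of the diagonal. -/
structure IsStarter (f : ZMod n → ZMod n ⊕ Fin k) (g h : Fin k → ZMod n) : Prop where
  zero : f 0 = .inl 0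
  row : Function.Injective (rowMap f h)
  col : Function.Injective (colMap f g)
  pair : Function.Injective (pairMap f g h)

theorem translate_injective (t : ZMod n) : Function.Injective (translate (k := k) t) :=
  Sum.map_injective.2 ⟨add_right_injective t, Function.injective_id⟩

theorem translate_translate (t t' : ZMod n) (u : ZMod n ⊕ Fin k) :
    translate t (translate t' u) = translate (t + t') u := by
  cases u <;> simp [translate, add_assoc]

theorem pairType_translate (t : ZMod n) (u v : ZMod n ⊕ Fin k) :
    pairType (translate t u) (translate t v) = pairType u v := by
  cases u <;> cases v <;> simp [translate, pairType]

/-- The square generated by starting data, with `o` filling the subsquare at infinity. -/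
def develop (f : ZMod n → ZMod n ⊕ Fin k) (g h : Fin k → ZMod n) (o : Fin k → Fin k → Fin k) :
    ZMod n ⊕ Fin k → ZMod n ⊕ Fin k → ZMod n ⊕ Fin k
  | .inl x, .inl y => translate x (f (y - x))
  | .inr i, .inl y => .inl (y + g i)
  | .inl x, .inr j => .inl (x + h j)
  | .inr i, .inr j => .inr (o i j)

variable {f : ZMod n → ZMod n ⊕ Fin k} {g h : Fin k → ZMod n} {o : Fin k → Fin k → Fin k}

theorem pairType_develop (u v : ZMod n ⊕ Fin k) (huv : u.isLeft ∨ v.isLeft) :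
    pairType (develop f g h o u v) (develop f g h o v u) = pairMap f g h (pairType u v) := by
  rcases u with x | i <;> rcases v with y | j
  · have : translate y (f (x - y)) = translate x (translate (y - x) (f (-(y - x)))) := by
      rw [translate_translate, add_sub_cancel, neg_sub]
    simp only [develop, this, pairType_translate]
    rfl
  · simp [develop, pairType, pairMap]
  · simp [develop, pairType, pairMap]
  · simp at huv

theorem IsStarter.isRight_of_isRight (H : IsStarter f g h) {u v : ZMod n ⊕ Fin k}
    (h₁ : (develop f g h o u v).isRight) (h₂ : (develop f g h o v u).isRight) :
    u.isRight ∧ v.isRight := by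
  rcases u with x | i <;> rcases v with y | j
  · -- the junk value of `pairType` forces the position onto the diagonal, where entries are finite
    have h₃ := pairType_develop (o := o) (f := f) (g := g) (h := h) (.inl x) (.inl y) (by simp)
    obtain ⟨a, ha⟩ := Sum.isRight_iff.1 h₁
    obtain ⟨b, hb⟩ := Sum.isRight_iff.1 h₂
    rw [ha, hb] at h₃
    have h₄ : y - x = 0 := by
      simpa using H.pair (a₁ := .inl (y - x)) (a₂ := .inl 0) (by
        rw [show (.inl (y - x) : ZMod n ⊕ Bool × Fin k) =
          pairType (.inl x : ZMod n ⊕ Fin k) (.inl y) from rfl, ← h₃]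
        simp [H.zero, pairType, pairMap, translate])
    simp [develop, h₄, H.zero, translate] at h₁
  · simp [develop] at h₁
  · simp [develop] at h₁
  · simp

theorem IsStarter.isSOLS (H : IsStarter f g h) (ho : IsSOLS o) : IsSOLS (develop f g h o) where
  idem u := by
    cases u
    · simp [develop, H.zero, translate]
    · simp [develop, ho.idem]
  left_inj u v v' e := by
    rcases u with x | i
    · have key : ∀ v, develop f g h o (.inl x) v =
          translate x (rowMap f h (translate (-x) v)) := by
        rintro (y | j) <;> simp [develop, rowMap, translate, neg_add_eq_sub]
      rw [key, key] at e
      exact translate_injective _ (H.row (translate_injective _ e))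
    · rcases v with y | j <;> rcases v' with y' | j' <;> simp [develop] at e
      · rw [e]
      · rw [ho.left_inj _ e]
  right_inj v u u' e := by
    change develop f g h o u v = develop f g h o u' v at e
    rcases v with y | j
    · let r : ZMod n ⊕ Fin k → ZMod n ⊕ Fin k := Sum.map (y - ·) id
      have hr : Function.Injective r :=
        Sum.map_injective.2 ⟨sub_right_injective, Function.injective_id⟩
      have key : ∀ u, develop f g h o u (.inl y) =
          translate y (colMap f g (r u)) := by
        rintro (x | i)
        · simp only [develop, colMap, r, Sum.map_inl, Sum.elim_inl, translate_translate]
          simp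
        · simp [develop, colMap, translate, r]
      rw [key, key] at e
      exact hr (H.col (translate_injective _ e))
    · rcases u with x | i <;> rcases u' with x' | i' <;> simp [develop] at e
      · rw [e]
      · rw [show i = i' from ho.right_inj j e]
  self_orth u v u' v' e₁ e₂ := by
    by_cases hfin : u.isRight ∧ v.isRight
    · obtain ⟨i, rfl⟩ := Sum.isRight_iff.1 hfin.1
      obtain ⟨j, rfl⟩ := Sum.isRight_iff.1 hfin.2
      obtain ⟨h₁, h₂⟩ := H.isRight_of_isRight (o := o) (u := u') (v := v') (by rw [← e₁]; rfl)
        (by rw [← e₂]; rfl)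
      obtain ⟨i', rfl⟩ := Sum.isRight_iff.1 h₁
      obtain ⟨j', rfl⟩ := Sum.isRight_iff.1 h₂
      have := ho.self_orth (Sum.inr_injective e₁) (Sum.inr_injective e₂)
      rw [this.1, this.2]
      exact ⟨rfl, rfl⟩
    have hfin' : ¬(u'.isRight ∧ v'.isRight) := by
      rintro ⟨h₁, h₂⟩
      obtain ⟨i, rfl⟩ := Sum.isRight_iff.1 h₁
      obtain ⟨j, rfl⟩ := Sum.isRight_iff.1 h₂
      exact hfin (H.isRight_of_isRight (o := o) (by rw [e₁]; rfl) (by rw [e₂]; rfl))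
    have hl : ∀ w z : ZMod n ⊕ Fin k, ¬(w.isRight ∧ z.isRight) → w.isLeft ∨ z.isLeft := by
      rintro (_ | _) (_ | _) <;> simp
    have ht : pairType u v = pairType u' v' := by
      apply H.pair
      rw [← pairType_develop (o := o) u v (hl _ _ hfin),
        ← pairType_develop (o := o) u' v' (hl _ _ hfin'), e₁, e₂]
    -- positions of equal type are translates of each other
    obtain ⟨t, rfl, rfl⟩ : ∃ t, u' = translate t u ∧ v' = translate t v := by
      rcases u with x | i <;> rcases v with y | j <;> rcases u' with x' | i' <;>
        rcases v' with y' | j' <;> simp [pairType] at ht hfin hfin'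
      · refine ⟨x' - x, by simp [translate], ?_⟩
        simp only [translate, Sum.map_inl, Sum.inl.injEq]
        linear_combination -ht
      · exact ⟨x' - x, by simp [translate], by simp [translate, ht]⟩
      · exact ⟨y' - y, by simp [translate, ht], by simp [translate]⟩
    have hdev : ∀ w z : ZMod n ⊕ Fin k, develop f g h o (translate t w) (translate t z) =
        translate t (develop f g h o w z) := by
      rintro (x | i) (y | j)
      · simp only [translate, Sum.map_inl, develop, add_sub_add_left_eq_sub]
        exact (translate_translate _ _ _).symm
      · simp [translate, develop, add_assoc]
      · simp [translate, develop, add_assoc]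
      · rfl
    rw [hdev] at e₁ e₂
    have ht0 : t = 0 := by
      have hz : ∀ w : ZMod n ⊕ Fin k, w.isLeft → w = translate t w → t = 0 := by
        rintro (x | i) hw e
        · simpa [translate] using e
        · simp at hw
      rcases hl (develop f g h o u v) (develop f g h o v u)
        (fun hr => hfin (H.isRight_of_isRight hr.1 hr.2)) with hw | hw
      exacts [hz _ hw e₁, hz _ hw e₂]
    subst ht0
    have : ∀ w : ZMod n ⊕ Fin k, w = translate 0 w := by rintro (_ | _) <;> simp [translate]
    exact ⟨this u, this v⟩

theorem IsStarter.hasSOLS [NeZero n] (H : IsStarter f g h) (hk : HasSOLS k) : HasSOLS (n + k) :=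
  let ⟨_, ho⟩ := hk
  .of_isSOLS (by simp) (H.isSOLS ho)

theorem IsStarter.hasSOLSWithSub [NeZero n] (H : IsStarter f g h) (hk2 : 2 ≤ k) (hk : HasSOLS k) :
    HasSOLSWithSub (n + k) := by
  obtain ⟨o, ho⟩ := hk
  refine .of_isSOLS (by simp) (H.isSOLS ho) (S := Set.range .inr) ⟨?_, ?_, ?_⟩
  · rintro _ ⟨i, rfl⟩ _ ⟨j, rfl⟩
    exact ⟨o i j, rfl⟩
  · exact ⟨.inr ⟨0, by omega⟩, ⟨_, rfl⟩, .inr ⟨1, by omega⟩, ⟨_, rfl⟩, by simp⟩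
  · intro e
    have : (.inl 0 : ZMod n ⊕ Fin k) ∈ Set.range Sum.inr := e ▸ Set.mem_univ _
    simp at this

end Cyclic

/-! ### Non-classical quantum Latin squares -/

open QuantumLatin
open scoped InnerProductSpace TensorProduct

section Quantum

variable {v : ℕ}

theorem isOrthoBasis_of_card {ι E : Type*} [Fintype ι] [NormedAddCommGroup E]
    [InnerProductSpace ℂ E] [FiniteDimensional ℂ E] {b : ι → E} (hb : Orthonormal ℂ b)
    (hc : Fintype.card ι = Module.finrank ℂ E) : IsOrthoBasis b :=
  ⟨hb, hb.linearIndependent.span_eq_top_of_card_eq_finrank' hc⟩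

/-- The standard basis rotated in the plane of the coordinates `a` and `b`. The coefficients
`3/5` and `4/5` only serve to make the rotation nontrivial. -/
noncomputable def rotated (a b i : Fin v) : CSpace v :=
  if i = a then EuclideanSpace.single a (3 / 5 : ℂ) + EuclideanSpace.single b (4 / 5 : ℂ)
  else if i = b then EuclideanSpace.single b (3 / 5 : ℂ) - EuclideanSpace.single a (4 / 5 : ℂ)
  else EuclideanSpace.single i 1

theorem inner_single_single (i j : Fin v) (c d : ℂ) :
    ⟪(EuclideanSpace.single i c : CSpace v), EuclideanSpace.single j d⟫_ℂ =
      if i = j then star c * d else 0 := by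
  rw [EuclideanSpace.inner_single_left]
  by_cases h : i = j
  · simp [h]
  · simp [h]

theorem orthonormal_rotated {a b : Fin v} (hab : a ≠ b) : Orthonormal ℂ (rotated a b) := by
  rw [orthonormal_iff_ite]
  intro i j
  by_cases hia : i = a <;> by_cases hib : i = b <;> by_cases hja : j = a <;>
    by_cases hjb : j = b <;> by_cases hij : i = j <;> subst_vars <;>
    simp_all [-inner_self_eq_norm_sq_to_K, rotated, inner_add_left, inner_add_right,
      inner_sub_left, inner_sub_right, inner_single_single, eq_comm] <;> norm_num

/-- The table `op` with its symbols read as standard basis vectors outside `S × S`, and as rotated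
basis vectors on the subsquare `S × S`. -/
noncomputable def rotatedArray (op : Fin v → Fin v → Fin v) (S : Set (Fin v)) (a b : Fin v) :
    VecArray v :=
  open Classical in
  fun i j => if i ∈ S ∧ j ∈ S then rotated a b (op i j) else EuclideanSpace.single (op i j) 1

theorem orthonormal_standard :
    Orthonormal ℂ fun i : Fin v => (EuclideanSpace.single i 1 : CSpace v) :=
  EuclideanSpace.orthonormal_single

theorem inner_rotated_single_of_mem {S : Set (Fin v)} {a b i j : Fin v} (ha : a ∈ S) (hb : b ∈ S)
    (hi : i ∈ S) (hj : j ∉ S) : ⟪rotated a b i, EuclideanSpace.single j 1⟫_ℂ = 0 := by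
  have hne : ∀ x ∈ S, x ≠ j := fun x hx e => hj (e ▸ hx)
  unfold rotated
  split_ifs
  · rw [inner_add_left, inner_single_single, inner_single_single, if_neg (hne _ ha),
      if_neg (hne _ hb), add_zero]
  · rw [inner_sub_left, inner_single_single, inner_single_single, if_neg (hne _ hb),
      if_neg (hne _ ha), sub_zero]
  · simp [inner_single_single, hne _ hi]

variable {op : Fin v → Fin v → Fin v} {S : Set (Fin v)} {a b : Fin v}

theorem rotatedArray_of_mem {i j : Fin v} (h : i ∈ S ∧ j ∈ S) :
    rotatedArray op S a b i j = rotated a b (op i j) := if_pos h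

theorem rotatedArray_of_not_mem {i j : Fin v} (h : ¬(i ∈ S ∧ j ∈ S)) :
    rotatedArray op S a b i j = EuclideanSpace.single (op i j) 1 := if_neg h

theorem norm_rotatedArray (hab : a ≠ b) (i j : Fin v) : ‖rotatedArray op S a b i j‖ = 1 := by
  by_cases h : i ∈ S ∧ j ∈ S
  · rw [rotatedArray_of_mem h, (orthonormal_rotated hab).1]
  · rw [rotatedArray_of_not_mem h, orthonormal_standard.1]

/-- Entries of two cells that are both inside or both outside the subsquare are orthogonal if their
symbols differ. -/
theorem inner_rotatedArray_of_iff (hab : a ≠ b) {i j i' j' : Fin v} (hne : op i j ≠ op i' j')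
    (h : i ∈ S ∧ j ∈ S ↔ i' ∈ S ∧ j' ∈ S) :
    ⟪rotatedArray op S a b i j, rotatedArray op S a b i' j'⟫_ℂ = 0 := by
  by_cases h' : i ∈ S ∧ j ∈ S
  · rw [rotatedArray_of_mem h', rotatedArray_of_mem (h.1 h'), (orthonormal_rotated hab).2 hne]
  · rw [rotatedArray_of_not_mem h', rotatedArray_of_not_mem (mt h.2 h'),
      orthonormal_standard.2 hne]

/-- Rotation does not leave `ℂ^S`, so an entry of the subsquare is orthogonal to every entry whose
symbol lies outside `S`. -/
theorem inner_rotatedArray_of_not_mem (hS : IsProperSub op S) (ha : a ∈ S) (hb : b ∈ S)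
    {i j i' j' : Fin v} (h : i ∈ S ∧ j ∈ S) (h' : op i' j' ∉ S) :
    ⟪rotatedArray op S a b i j, rotatedArray op S a b i' j'⟫_ℂ = 0 := by
  rw [rotatedArray_of_mem h, rotatedArray_of_not_mem fun h₁ => h' (hS.closed _ h₁.1 _ h₁.2),
    inner_rotated_single_of_mem ha hb (hS.closed _ h.1 _ h.2) h']

theorem mem_of_injective {X : Type*} [Finite X] {f : X → X} (hf : Function.Injective f) {T : Set X}
    (hT : Set.MapsTo f T T) {x : X} (hx : f x ∈ T) : x ∈ T := by
  have : f '' T = T := Set.eq_of_subset_of_ncard_le hT.image_subset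
    (Set.ncard_image_of_injective T hf).ge
  rw [← this] at hx
  exact hf.mem_set_image.1 hx

theorem IsSOLS.mem_iff_right (h : IsSOLS op) (hS : IsProperSub op S) {i j : Fin v} (hi : i ∈ S) :
    op i j ∈ S ↔ j ∈ S :=
  ⟨mem_of_injective (h.left_inj i) (hS.closed i hi), hS.closed i hi j⟩

/-- The pairs `(op i j, op j i)` with `i, j ∈ S` exhaust `S × S`, so no other cell produces a pair
of symbols from `S`. -/
theorem IsSOLS.mem_of_pair (h : IsSOLS op) (hS : IsProperSub op S) {i j : Fin v}
    (h₁ : op i j ∈ S) (h₂ : op j i ∈ S) : i ∈ S ∧ j ∈ S := by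
  have := mem_of_injective (f := fun p : Fin v × Fin v => (op p.1 p.2, op p.2 p.1)) (T := S ×ˢ S)
    (x := (i, j)) ?_ ?_ ⟨h₁, h₂⟩
  · exact this
  · intro p q e
    simp only [Prod.mk.injEq] at e
    exact Prod.ext_iff.2 (h.self_orth e.1 e.2)
  · exact fun p hp => ⟨hS.closed _ hp.1 _ hp.2, hS.closed _ hp.2 _ hp.1⟩

theorem isOrthoBasis_rotatedArray_row (h : IsSOLS op) (hS : IsProperSub op S) (hab : a ≠ b)
    (ha : a ∈ S) (hb : b ∈ S) (i : Fin v) : IsOrthoBasis fun j => rotatedArray op S a b i j := by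
  refine isOrthoBasis_of_card ⟨fun j => norm_rotatedArray hab i j, ?_⟩ (by simp)
  have key : ∀ j j', i ∈ S ∧ j ∈ S → ¬(i ∈ S ∧ j' ∈ S) →
      ⟪rotatedArray op S a b i j, rotatedArray op S a b i j'⟫_ℂ = 0 := fun j j' h₁ h₂ =>
    inner_rotatedArray_of_not_mem hS ha hb h₁ fun h₃ =>
      h₂ ⟨h₁.1, (h.mem_iff_right hS h₁.1).1 h₃⟩
  intro j j' hne
  by_cases h₁ : i ∈ S ∧ j ∈ S <;> by_cases h₂ : i ∈ S ∧ j' ∈ S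
  · exact inner_rotatedArray_of_iff hab ((h.left_inj i).ne hne) (iff_of_true h₁ h₂)
  · exact key _ _ h₁ h₂
  · exact inner_eq_zero_symm.1 (key _ _ h₂ h₁)
  · exact inner_rotatedArray_of_iff hab ((h.left_inj i).ne hne) (iff_of_false h₁ h₂)

theorem rotatedArray_flip (i j : Fin v) :
    rotatedArray (flip op) S a b i j = rotatedArray op S a b j i := by
  by_cases hi : i ∈ S <;> by_cases hj : j ∈ S <;> simp [rotatedArray, flip, hi, hj]

theorem isQLS_rotatedArray (h : IsSOLS op) (hS : IsProperSub op S) (hab : a ≠ b)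
    (ha : a ∈ S) (hb : b ∈ S) : IsQLS (rotatedArray op S a b) := by
  refine ⟨isOrthoBasis_rotatedArray_row h hS hab ha hb, fun j => ?_⟩
  simpa only [rotatedArray_flip] using isOrthoBasis_rotatedArray_row h.flip hS.flip hab ha hb j

theorem isIdempotent_rotatedArray (h : IsSOLS op) (hS : IsProperSub op S) (hab : a ≠ b)
    (ha : a ∈ S) (hb : b ∈ S) : IsIdempotent (rotatedArray op S a b) := by
  refine isOrthoBasis_of_card ⟨fun i => norm_rotatedArray hab i i, ?_⟩ (by simp)
  have key : ∀ i j, i ∈ S → j ∉ S →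
      ⟪rotatedArray op S a b i i, rotatedArray op S a b j j⟫_ℂ = 0 := fun i j h₁ h₂ =>
    inner_rotatedArray_of_not_mem hS ha hb ⟨h₁, h₁⟩ (by rwa [h.idem])
  intro i j hne
  have hne' : op i i ≠ op j j := by rwa [h.idem, h.idem]
  by_cases h₁ : i ∈ S <;> by_cases h₂ : j ∈ S
  · exact inner_rotatedArray_of_iff hab hne' (iff_of_true ⟨h₁, h₁⟩ ⟨h₂, h₂⟩)
  · exact key _ _ h₁ h₂
  · exact inner_eq_zero_symm.1 (key _ _ h₂ h₁)
  · exact inner_rotatedArray_of_iff hab hne' (iff_of_false (fun e => h₁ e.1) (fun e => h₂ e.1))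

theorem areOrthogonal_rotatedArray (h : IsSOLS op) (hS : IsProperSub op S) (hab : a ≠ b)
    (ha : a ∈ S) (hb : b ∈ S) :
    AreOrthogonal (rotatedArray op S a b) (rotatedArray (flip op) S a b) := by
  refine isOrthoBasis_of_card ⟨fun p => ?_, ?_⟩ (by simp [Module.finrank_tensorProduct])
  · rw [TensorProduct.norm_tmul, norm_rotatedArray hab, norm_rotatedArray hab, one_mul]
  have key : ∀ i j i' j', i ∈ S ∧ j ∈ S → ¬(i' ∈ S ∧ j' ∈ S) →
      ⟪rotatedArray op S a b i j, rotatedArray op S a b i' j'⟫_ℂ *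
        ⟪rotatedArray (flip op) S a b i j, rotatedArray (flip op) S a b i' j'⟫_ℂ = 0 := by
    intro i j i' j' h₁ h₂
    by_cases h₃ : op i' j' ∈ S
    · rw [inner_rotatedArray_of_not_mem hS.flip ha hb h₁ fun h₄ => h₂ (h.mem_of_pair hS h₃ h₄),
        mul_zero]
    · rw [inner_rotatedArray_of_not_mem hS ha hb h₁ h₃, zero_mul]
  have key' : ∀ i j i' j', (i, j) ≠ (i', j') → (i ∈ S ∧ j ∈ S ↔ i' ∈ S ∧ j' ∈ S) →
      ⟪rotatedArray op S a b i j, rotatedArray op S a b i' j'⟫_ℂ *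
        ⟪rotatedArray (flip op) S a b i j, rotatedArray (flip op) S a b i' j'⟫_ℂ = 0 := by
    intro i j i' j' hne hiff
    by_cases h₁ : op i j = op i' j'
    · have h₂ : flip op i j ≠ flip op i' j' := fun h₂ =>
        hne (Prod.ext_iff.2 (h.self_orth h₁ h₂))
      rw [inner_rotatedArray_of_iff hab h₂ hiff, mul_zero]
    · rw [inner_rotatedArray_of_iff hab h₁ hiff, zero_mul]
  rintro ⟨i, j⟩ ⟨i', j'⟩ hne
  rw [TensorProduct.inner_tmul]
  by_cases h₁ : i ∈ S ∧ j ∈ S <;> by_cases h₂ : i' ∈ S ∧ j' ∈ S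
  · exact key' _ _ _ _ hne (iff_of_true h₁ h₂)
  · exact key _ _ _ _ h₁ h₂
  · have := key _ _ _ _ h₂ h₁
    rw [mul_eq_zero] at this ⊢
    exact this.imp inner_eq_zero_symm.1 inner_eq_zero_symm.1
  · exact key' _ _ _ _ hne (iff_of_false h₁ h₂)

/-- The entries of a classical square are pairwise parallel or orthogonal. -/
theorem norm_inner_of_isClassical {Φ : VecArray v} (h : IsClassical Φ) (i j i' j' : Fin v) :
    ‖⟪Φ i j, Φ i' j'⟫_ℂ‖ = 0 ∨ ‖⟪Φ i j, Φ i' j'⟫_ℂ‖ = 1 := by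
  obtain ⟨L, -, U, c, σ, τ, hc, hΦ⟩ := h
  rw [hΦ, hΦ, inner_smul_left, inner_smul_right, U.inner_map_map, ofSymbols, ofSymbols,
    inner_single_single]
  split_ifs <;> simp [hc]

/-- The symbol `a` occurs both inside and outside the subsquare, which produces two entries that are
neither parallel nor orthogonal. -/
theorem not_isClassical_rotatedArray (h : IsSOLS op) (hS : IsProperSub op S) (hab : a ≠ b)
    (ha : a ∈ S) : ¬IsClassical (rotatedArray op S a b) := by
  intro hcl
  obtain ⟨i, hi⟩ := (Set.ne_univ_iff_exists_notMem S).1 hS.ne_univ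
  obtain ⟨j, hj⟩ := Finite.surjective_of_injective (h.left_inj i) a
  have := norm_inner_of_isClassical hcl a a i j
  rw [rotatedArray_of_mem ⟨ha, ha⟩, rotatedArray_of_not_mem fun e => hi e.1, h.idem, hj, rotated,
    if_pos rfl, inner_add_left, inner_single_single, inner_single_single, if_pos rfl,
    if_neg hab.symm] at this
  norm_num at this

theorem HasSOLSWithSub.exists_idempotentMOQLS (h : HasSOLSWithSub v) :
    ∃ F : Fin 2 → VecArray v, IsIdempotentMOQLS F ∧ ∀ f, ¬IsClassical (F f) := by
  obtain ⟨op, S, h, hS⟩ := h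
  obtain ⟨a, ha, b, hb, hab⟩ := hS.nontrivial
  refine ⟨![rotatedArray op S a b, rotatedArray (flip op) S a b], ⟨?_, ?_⟩, ?_⟩
  · rw [Fin.forall_fin_two]
    exact ⟨⟨isQLS_rotatedArray h hS hab ha hb, isIdempotent_rotatedArray h hS hab ha hb⟩,
      isQLS_rotatedArray h.flip hS.flip hab ha hb,
      isIdempotent_rotatedArray h.flip hS.flip hab ha hb⟩
  · intro f g hfg
    obtain ⟨rfl, rfl⟩ : f = 0 ∧ g = 1 := by omega
    exact areOrthogonal_rotatedArray h hS hab ha hb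
  · rw [Fin.forall_fin_two]
    exact ⟨not_isClassical_rotatedArray h hS hab ha,
      not_isClassical_rotatedArray h.flip hS.flip hab ha⟩

end Quantum

/-! ### Starting data for single orders -/

section Lists

variable {n k : ℕ} [NeZero n]

instance (f : ZMod n → ZMod n ⊕ Fin k) (g h : Fin k → ZMod n) : Decidable (IsStarter f g h) :=
  have : Fintype (ZMod n) := ZMod.fintype n
  decidable_of_iff (f 0 = .inl 0 ∧ (rowMap f h).Injective ∧ (colMap f g).Injective ∧
      (pairMap f g h).Injective)
    ⟨fun H => ⟨H.1, H.2.1, H.2.2.1, H.2.2.2⟩, fun H => ⟨H.zero, H.row, H.col, H.pair⟩⟩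

/-- Row `0` of a developed square read from a list, in which `n + j` stands for the point at
infinity `∞_j`. -/
def readRow (n k : ℕ) [NeZero n] [NeZero k] (F : List ℕ) (d : ZMod n) : ZMod n ⊕ Fin k :=
  let a := F.getD d.val 0
  if a < n then .inl a else .inr (Fin.ofNat k (a - n))

/-- The entries of a list as residues modulo `n`. -/
def readList (n k : ℕ) (l : List ℕ) (j : Fin k) : ZMod n :=
  l.getD j 0

/-- The starting data encoded by three lists. The lists used below result from a search; that they
satisfy the conditions of `IsStarter` is a finite check. -/
def IsListStarter (n k : ℕ) [NeZero n] [NeZero k] (F g h : List ℕ) : Prop :=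
  IsStarter (readRow n k F) (readList n k g) (readList n k h)

instance (n k : ℕ) [NeZero n] [NeZero k] (F g h : List ℕ) : Decidable (IsListStarter n k F g h) :=
  inferInstanceAs (Decidable (IsStarter _ _ _))

theorem IsListStarter.hasSOLS [NeZero k] {F g h : List ℕ} (H : IsListStarter n k F g h)
    (hk : HasSOLS k) : HasSOLS (n + k) :=
  IsStarter.hasSOLS H hk

theorem IsListStarter.hasSOLSWithSub [NeZero k] {F g h : List ℕ} (H : IsListStarter n k F g h)
    (hk2 : 2 ≤ k) (hk : HasSOLS k) : HasSOLSWithSub (n + k) :=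
  IsStarter.hasSOLSWithSub H hk2 hk

theorem HasSOLS.of_coprime_six {n : ℕ} (hn : n.Coprime 6) : HasSOLS n :=
  (HasSlopes.of_coprime_six hn).hasSOLS

theorem hasSlopes_four : HasSlopes 4 :=
  .of_prime_pow (p := 2) (k := 2) Nat.prime_two (by norm_num) (by norm_num)

theorem hasSlopes_eight : HasSlopes 8 :=
  .of_prime_pow (p := 2) (k := 3) Nat.prime_two (by norm_num) (by norm_num)

theorem hasSlopes_nine : HasSlopes 9 :=
  .of_prime_pow (p := 3) (k := 2) Nat.prime_three (by norm_num) (by norm_num)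

theorem hasSOLS_four : HasSOLS 4 := hasSlopes_four.hasSOLS

theorem hasSOLS_five : HasSOLS 5 := .of_coprime_six (by norm_num)

theorem hasSOLS_10 : HasSOLS 10 :=
  have H : IsListStarter 9 1 [0, 2, 5, 8, 1, 9, 4, 6, 3]
      [2]
      [7] := by decide +kernel
  H.hasSOLS (.of_le_one le_rfl)

theorem hasSOLS_12 : HasSOLS 12 :=
  have H : IsListStarter 11 1 [0, 7, 5, 1, 6, 10, 3, 11, 4, 2, 9]
      [1]
      [8] := by decide +kernel
  H.hasSOLS (.of_le_one le_rfl)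

theorem hasSOLS_14 : HasSOLS 14 :=
  have H : IsListStarter 13 1 [0, 4, 3, 7, 10, 12, 11, 2, 6, 13, 9, 8, 1]
      [9]
      [5] := by decide +kernel
  H.hasSOLS (.of_le_one le_rfl)

theorem hasSOLS_15 : HasSOLS 15 :=
  have H : IsListStarter 14 1 [0, 2, 10, 6, 1, 4, 13, 3, 12, 11, 14, 9, 7, 5]
      [5]
      [8] := by decide +kernel
  H.hasSOLS (.of_le_one le_rfl)

theorem hasSOLS_18 : HasSOLS 18 :=
  have H : IsListStarter 17 1 [0, 8, 3, 6, 15, 14, 11, 2, 16, 13, 17, 7, 5, 10, 12, 4, 1]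
      [16]
      [9] := by decide +kernel
  H.hasSOLS (.of_le_one le_rfl)

theorem hasSOLSWithSub_13 : HasSOLSWithSub 13 :=
  have H : IsListStarter 9 4 [0, 2, 10, 11, 6, 12, 5, 3, 9]
      [7, 6, 4, 3]
      [8, 4, 1, 7] := by decide +kernel
  H.hasSOLSWithSub (by norm_num) hasSOLS_four

theorem hasSOLSWithSub_22 : HasSOLSWithSub 22 :=
  have H : IsListStarter 15 7 [0, 5, 20, 14, 1, 19, 9, 21, 13, 17, 8, 15, 18, 6, 16]
      [14, 10, 6, 1, 7, 9, 2]
      [3, 11, 12, 4, 2, 7, 10] := by decide +kernel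
  H.hasSOLSWithSub (by norm_num) (.of_coprime_six (by norm_num))

theorem hasSOLSWithSub_26 : HasSOLSWithSub 26 :=
  have H : IsListStarter 19 7 [0, 15, 5, 14, 13, 7, 25, 20, 19, 3, 21, 18, 1, 9, 23, 22, 24, 2,
      16]
      [1, 18, 16, 6, 12, 5, 10]
      [12, 11, 6, 10, 17, 8, 4] := by decide +kernel
  H.hasSOLSWithSub (by norm_num) (.of_coprime_six (by norm_num))

theorem hasSOLSWithSub_27 : HasSOLSWithSub 27 :=
  have H : IsListStarter 23 4 [0, 2, 12, 20, 9, 3, 8, 21, 14, 17, 5, 23, 15, 1, 18, 22, 24, 6, 25,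
      16, 19, 11, 26]
      [9, 15, 16, 19]
      [4, 7, 13, 10] := by decide +kernel
  H.hasSOLSWithSub (by norm_num) hasSOLS_four

theorem hasSOLSWithSub_30 : HasSOLSWithSub 30 :=
  have H : IsListStarter 23 7 [0, 15, 3, 18, 10, 26, 22, 5, 28, 8, 27, 13, 29, 16, 19, 11, 24, 14,
      12, 23, 1, 7, 25]
      [13, 18, 8, 11, 7, 12, 10]
      [17, 2, 9, 6, 20, 4, 21] := by decide +kernel
  H.hasSOLSWithSub (by norm_num) (.of_coprime_six (by norm_num))

theorem hasSOLSWithSub_31 : HasSOLSWithSub 31 :=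
  have H : IsListStarter 21 10 [0, 26, 20, 27, 21, 30, 15, 22, 29, 13, 28, 5, 24, 18, 4, 25, 14,
      8, 7, 23, 19]
      [13, 17, 1, 8, 6, 2, 14, 16, 3, 7]
      [9, 10, 3, 17, 12, 1, 11, 6, 16, 2] := by decide +kernel
  H.hasSOLSWithSub (by norm_num) hasSOLS_10

theorem hasSOLSWithSub_34 : HasSOLSWithSub 34 :=
  have H : IsListStarter 23 11 [0, 20, 17, 14, 11, 24, 5, 33, 22, 19, 25, 28, 10, 7, 23, 32, 21,
      27, 15, 31, 26, 30, 29]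
      [4, 8, 16, 9, 18, 13, 3, 6, 12, 1, 2]
      [13, 3, 6, 12, 1, 2, 4, 8, 16, 9, 18] := by decide +kernel
  H.hasSOLSWithSub (by norm_num) (.of_coprime_six (by norm_num))

theorem hasSOLSWithSub_38 : HasSOLSWithSub 38 :=
  have H : IsListStarter 31 7 [0, 27, 18, 8, 34, 6, 21, 28, 2, 15, 3, 32, 26, 33, 23, 12, 7, 35,
      20, 11, 1, 9, 4, 30, 37, 36, 24, 13, 17, 25, 31]
      [4, 30, 11, 18, 8, 10, 3]
      [5, 19, 29, 14, 22, 16, 10] := by decide +kernel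
  H.hasSOLSWithSub (by norm_num) (.of_coprime_six (by norm_num))

theorem hasSOLSWithSub_42 : HasSOLSWithSub 42 :=
  have H : IsListStarter 31 11 [0, 32, 30, 22, 34, 29, 15, 14, 20, 3, 1, 25, 10, 8, 38, 18, 37,
      27, 33, 31, 35, 36, 23, 39, 41, 12, 40, 16, 13, 6, 26]
      [21, 5, 23, 15, 6, 30, 13, 4, 11, 2, 17]
      [2, 4, 5, 11, 17, 9, 28, 21, 19, 7, 24] := by decide +kernel
  H.hasSOLSWithSub (by norm_num) (.of_coprime_six (by norm_num))

theorem hasSOLSWithSub_46 : HasSOLSWithSub 46 :=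
  have H : IsListStarter 31 15 [0, 8, 16, 9, 1, 34, 18, 37, 2, 32, 35, 13, 5, 21, 38, 41, 4, 20,
      33, 36, 31, 22, 26, 45, 10, 40, 11, 44, 39, 43, 42]
      [18, 5, 10, 20, 9, 26, 21, 11, 22, 13, 27, 23, 15, 30, 29]
      [29, 27, 23, 15, 30, 7, 14, 28, 25, 19, 12, 24, 17, 3, 6] := by decide +kernel
  H.hasSOLSWithSub (by norm_num) hasSOLS_15

theorem hasSOLSWithSub_47 : HasSOLSWithSub 47 :=
  have H : IsListStarter 37 10 [0, 29, 15, 33, 3, 24, 2, 38, 26, 13, 44, 42, 39, 11, 6, 41, 25,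
      46, 19, 30, 34, 43, 10, 45, 4, 27, 32, 5, 7, 36, 16, 20, 17, 37, 21, 18, 40]
      [34, 21, 10, 8, 27, 5, 12, 32, 31, 3]
      [1, 14, 35, 9, 12, 31, 28, 22, 8, 23] := by decide +kernel
  H.hasSOLSWithSub (by norm_num) hasSOLS_10

theorem hasSOLSWithSub_58 : HasSOLSWithSub 58 :=
  have H : IsListStarter 43 15 [0, 26, 6, 11, 52, 44, 27, 29, 43, 25, 16, 21, 36, 15, 47, 54, 17,
      10, 23, 30, 18, 50, 9, 40, 53, 49, 57, 55, 8, 1, 45, 46, 3, 56, 22, 4, 33, 12, 24, 5, 51,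
      48, 2]
      [39, 19, 28, 7, 42, 37, 20, 34, 32, 38, 13, 35, 26, 27, 33]
      [31, 14, 41, 19, 28, 39, 38, 13, 35, 34, 32, 20, 42, 37, 7] := by decide +kernel
  H.hasSOLSWithSub (by norm_num) hasSOLS_15

theorem hasSOLSWithSub_66 : HasSOLSWithSub 66 :=
  have H : IsListStarter 61 5 [0, 41, 8, 61, 34, 22, 5, 28, 30, 3, 33, 26, 54, 47, 58, 12, 25, 50,
      11, 9, 27, 48, 42, 10, 29, 21, 14, 62, 44, 53, 49, 23, 36, 17, 52, 24, 1, 32, 51, 13, 38,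
      63, 6, 46, 19, 15, 56, 59, 16, 20, 35, 4, 64, 31, 45, 37, 57, 43, 60, 39, 65]
      [37, 28, 8, 11, 38]
      [2, 18, 40, 55, 7] := by decide +kernel
  H.hasSOLSWithSub (by norm_num) hasSOLS_five

theorem hasSOLSWithSub_67 : HasSOLSWithSub 67 :=
  have H : IsListStarter 49 18 [0, 13, 50, 65, 57, 66, 22, 63, 11, 43, 4, 49, 9, 17, 62, 39, 59,
      25, 38, 53, 15, 40, 56, 55, 3, 16, 7, 28, 61, 35, 47, 52, 42, 23, 41, 34, 51, 21, 12, 58, 5,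
      64, 24, 60, 36, 14, 2, 20, 54]
      [37, 29, 32, 11, 2, 36, 42, 21, 35, 45, 26, 27, 9, 15, 25, 38, 47, 13]
      [26, 27, 45, 29, 32, 37, 19, 48, 31, 6, 10, 33, 30, 1, 18, 46, 44, 8] := by decide +kernel
  H.hasSOLSWithSub (by norm_num) hasSOLS_18

end Lists

/-! ### All orders -/

theorem hasSOLS_of_lt_twenty {t : ℕ} (ht : t < 20) (h2 : t ≠ 2) (h3 : t ≠ 3) (h6 : t ≠ 6) :
    HasSOLS t := by
  by_cases h : t.Coprime 6
  · exact .of_coprime_six h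
  interval_cases t
  any_goals contradiction
  exacts [.of_le_one (by norm_num), hasSOLS_four, hasSlopes_eight.hasSOLS, hasSlopes_nine.hasSOLS,
    hasSOLS_10, hasSOLS_12, hasSOLS_14, hasSOLS_15, (hasSlopes_four.mul hasSlopes_four).hasSOLS,
    hasSOLS_18]

/-- The group sizes of the transversal designs that are truncated for orders up to `130`. -/
def groupSizes : List ℕ := [4, 5, 7, 8, 9, 11, 13, 16, 17, 19, 23, 25, 28, 29]

/-- The orders up to `130` that are not reached by truncating a transversal design. -/
def exceptionalOrders : List ℕ :=
  [13, 22, 26, 27, 30, 31, 34, 38, 42, 46, 47, 50, 58, 66, 67, 70, 98]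

theorem hasSlopes_of_mem {m : ℕ} (hm : m ∈ groupSizes) : HasSlopes m := by
  by_cases h : m.Coprime 6
  · exact .of_coprime_six h
  fin_cases hm
  any_goals (refine absurd ?_ h; norm_num; done)
  exacts [hasSlopes_four, hasSlopes_eight, hasSlopes_nine, hasSlopes_four.mul hasSlopes_four,
    hasSlopes_four.mul (.of_coprime_six (n := 7) (by norm_num))]

set_option synthInstance.maxSize 1000 in
theorem hasSOLSWithSub_of_le {v : ℕ} (h13 : 13 ≤ v) (hv : v ≤ 130)
    (hex : v ∉ [14, 15, 18, 19, 23]) : HasSOLSWithSub v := by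
  have key : ∀ v < 131, 13 ≤ v → v ∉ [14, 15, 18, 19, 23] →
      v ∈ exceptionalOrders ∨ ∃ m ∈ groupSizes, 4 * m ≤ v ∧ v - 4 * m ≤ m ∧
        v - 4 * m < 20 ∧ v - 4 * m ∉ [2, 3, 6] := by
    decide +kernel
  rcases key v (by omega) h13 hex with h | ⟨m, hm, hmv, ht, h20, ht'⟩
  · have h5 := hasSOLS_five
    fin_cases h
    exacts [hasSOLSWithSub_13,
      hasSOLSWithSub_22,
      hasSOLSWithSub_26,
      hasSOLSWithSub_27,
      hasSOLSWithSub_30,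
      hasSOLSWithSub_31,
      hasSOLSWithSub_34,
      hasSOLSWithSub_38,
      hasSOLSWithSub_42,
      hasSOLSWithSub_46,
      hasSOLSWithSub_47,
      HasSOLS.mul (m := 5) (n := 10) (by norm_num) (by norm_num) h5 hasSOLS_10,
      hasSOLSWithSub_58,
      hasSOLSWithSub_66,
      hasSOLSWithSub_67,
      HasSOLS.mul (m := 7) (n := 10) (by norm_num) (by norm_num) (.of_coprime_six (by norm_num))
        hasSOLS_10,
      HasSOLS.mul (m := 7) (n := 14) (by norm_num) (by norm_num) (.of_coprime_six (by norm_num))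
        hasSOLS_14]
  · simp only [List.mem_cons, List.not_mem_nil, or_false, not_or] at ht'
    have := (hasSlopes_of_mem hm).hasSOLSWithSub (by fin_cases hm <;> norm_num) ht
      (hasSOLS_of_lt_twenty h20 ht'.1 ht'.2.1 ht'.2.2) hasSOLS_four hasSOLS_five
    rwa [Nat.add_sub_cancel' hmv] at this

theorem hasSOLS_of_le_thirty {t : ℕ} (h7 : 7 ≤ t) (ht : t ≤ 30) : HasSOLS t := by
  rcases lt_or_ge t 20 with h | h
  · exact hasSOLS_of_lt_twenty h (by omega) (by omega) (by omega)
  by_cases h23 : t = 23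
  · exact h23 ▸ .of_coprime_six (by norm_num)
  · exact (hasSOLSWithSub_of_le (by omega) (by omega) (by simp; omega)).hasSOLS

theorem hasSOLSWithSub {v : ℕ} (h13 : 13 ≤ v) (hex : v ∉ [14, 15, 18, 19, 23]) :
    HasSOLSWithSub v := by
  rcases le_or_gt v 130 with hv | hv
  · exact hasSOLSWithSub_of_le h13 hv hex
  -- the group size `6 q + 1` leaves a truncated group of size between `7` and `30`
  obtain ⟨q, hq⟩ : ∃ q, q = (v - 11) / 24 := ⟨_, rfl⟩
  have hm : (6 * q + 1).Coprime 6 := by simp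
  have := (HasSlopes.of_coprime_six hm).hasSOLSWithSub (t := v - 4 * (6 * q + 1)) (by omega)
    (by omega) (hasSOLS_of_le_thirty (by omega) (by omega)) hasSOLS_four hasSOLS_five
  rwa [show 4 * (6 * q + 1) + (v - 4 * (6 * q + 1)) = v by omega] at this

end SelfOrthogonal

theorem theorem3p4 (v : ℕ) (hv : 6 ≤ v)
    (hex : v ∉ ({6, 7, 8, 9, 10, 11, 12, 14, 15, 18, 19, 23} : Set ℕ)) :
    ∃ F : Fin 2 → QuantumLatin.VecArray v,
      QuantumLatin.IsIdempotentMOQLS F ∧ ∀ f, ¬ QuantumLatin.IsClassical (F f) := by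
  simp only [Set.mem_insert_iff, Set.mem_singleton_iff, not_or] at hex
  exact (SelfOrthogonal.hasSOLSWithSub (by omega) (by simp; omega)).exists_idempotentMOQLS
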